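/- **Theorem (Characterization of $\preccurlyeq_{ccx}$ by the Schur order).** Let $(Y,\mathbf X)$ and $(Y',\mathbf X')$ be random vectors, on possibly different probability spaces, where $Y,Y'$ are real-valued and $\mathbf X,\mathbf X'$ take values in $\mathbb R^p$ and $\mathbb R^{p'}$, respectively. No assumption is made on their distributions, and $p,p'$ need not be equal. Definitions. For a distribution function $F$ let $F^{-1}(t):=\inf\{y\in\mathbb R: F(y)\ge t\}$, $t\in(0,1)$, and put $q_Y:=F_Y^{-1}$, where $F_Y$ is the distribution function of $Y$. * For bounded random variables $S,T$, the convex order $S\le_{cx}T$ means $\mathbb E\,\varphi(S)\le\mathbb E\,\varphi(T)$ for all convex $\varphi:\mathbb R\to\mathbb R$. The conditional convex order $(Y,\mathbf X)\preccurlyeq_{ccx}(Y',\mathbf X')$ means $P(Y\ge q_Y(v)\mid\mathbf X)\le_{cx}P(Y'\ge q_{Y'}(v)\mid\mathbf X')$ for all $v\in(0,1)$. * The multivariate quantile transform $\mathbf q_{\mathbf X}:(0,1)^p\to\mathbb R^p$ is $\mathbf q_{\mathbf X}(\mathbf u)=(\zeta_1,\dots,\zeta_p)$ with $\zeta_1=F_{X_1}^{-1}(u_1)$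 and $\zeta_i=F^{-1}_{X_i\mid X_1=\zeta_1,\dots,X_{i-1}=\zeta_{i-1}}(u_i)$ for $i=2,\dots,p$, where $F_{X_i\mid X_1=x_1,\dots,X_{i-1}=x_{i-1}}$ is the conditional distribution function given by a regular conditional distribution. For $v\in(0,1)$ put $$\eta^v_{Y|\mathbf X}(\mathbf u):=P\big(Y\le q_Y(v)\mid \mathbf X=\mathbf q_{\mathbf X}(\mathbf u)\big),\qquad \mathbf u\in(0,1)^p .$$ * For an integrable $h:(0,1)^k\to\mathbb R$, its decreasing rearrangement $h^*:(0,1)\to\mathbb R$ is the (essentially unique) decreasing function with $\lambda(h^*\ge w)=\lambda^k(h\ge w)$ for all $w\in\mathbb R$, where $\lambda^k$ is Lebesgue measure on $(0,1)^k$ and $\lambda=\lambda^1$. For integrable $f:(0,1)^d\to\mathbb R$ and $g:(0,1)^{d'}\to\mathbb R$, the Schur order $f\prec_S g$ means $$\int_0^x f^*(t)\,dt\le\int_0^x g^*(t)\,dt\ \text{ for all }x\in(0,1)\quad\text{and}\quad \int_0^1 f^*(t)\,dt=\int_0^1 g^*(t)\,dt .$$ Then the following statements are equivalent: (i) $(Y,\mathbf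 X)\preccurlyeq_{ccx}(Y',\mathbf X')$; (ii) $\eta^v_{Y|\mathbf X}\prec_S\eta^v_{Y'|\mathbf X'}$ for Lebesgue-almost all $v\in(0,1)$. -/

import Mathlib

open MeasureTheory ProbabilityTheory Set

/-- The left-continuous generalized inverse `t ↦ inf {y | t ≤ F y}` of the distribution function
`F` of a probability measure `ν` on the real line. -/
noncomputable def leftQuantile (ν : Measure ℝ) (t : ℝ) : ℝ :=
  sInf {y : ℝ | t ≤ cdf ν y}

/-- The convex order `S ≤_cx T` of bounded real random variables, which may live on different
probability spaces: `E φ(S) ≤ E φ(T)` for all convex `φ : ℝ → ℝ`. (For bounded `S`, `T` and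
convex, hence continuous, `φ` both integrands are integrable.) -/
def ConvexOrderLE {Ω Ω' : Type*} [MeasurableSpace Ω] [MeasurableSpace Ω']
    (P : Measure Ω) (S : Ω → ℝ) (P' : Measure Ω') (T : Ω' → ℝ) : Prop :=
  ∀ φ : ℝ → ℝ, ConvexOn ℝ univ φ → ∫ ω, φ (S ω) ∂P ≤ ∫ ω, φ (T ω) ∂P'

/-- The conditional survival probability `P(Y ≥ q_Y(v) | X)`, a random variable on `Ω`. -/
noncomputable def condSurvival {Ω : Type*} [MeasurableSpace Ω] (P : Measure Ω) {p : ℕ}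
    (Y : Ω → ℝ) (X : Ω → Fin p → ℝ) (v : ℝ) : Ω → ℝ :=
  P⟦{ω | leftQuantile (P.map Y) v ≤ Y ω} | MeasurableSpace.comap X inferInstance⟧

/-- The conditional convex order `(Y, X) ≼_ccx (Y', X')`:
`P(Y ≥ q_Y(v) | X) ≤_cx P(Y' ≥ q_{Y'}(v) | X')` for all `v ∈ (0,1)`. -/
def CondConvexOrderLE {Ω Ω' : Type*} [MeasurableSpace Ω] [MeasurableSpace Ω'] {p p' : ℕ}
    (P : Measure Ω) (Y : Ω → ℝ) (X : Ω → Fin p → ℝ)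
    (P' : Measure Ω') (Y' : Ω' → ℝ) (X' : Ω' → Fin p' → ℝ) : Prop :=
  ∀ v ∈ Ioo (0 : ℝ) 1, ConvexOrderLE P (condSurvival P Y X v) P' (condSurvival P' Y' X' v)

/-- The multivariate quantile transform `q_X(u) = (ζ₁, …, ζ_p)` of a random vector `X`, where
`ζᵢ` is the left-continuous quantile function of the conditional law of `Xᵢ` given
`X₁ = ζ₁, …, Xᵢ₋₁ = ζᵢ₋₁`, evaluated at `uᵢ`. The recursion is on the dimension: `q` of the first
`p` coordinates is extended by the last coordinate. For the first coordinate the conditioning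
variable takes values in the one-point space `Fin 0 → ℝ`, so that `ζ₁ = F_{X₁}⁻¹(u₁)`. -/
noncomputable def quantileTransform {Ω : Type*} [MeasurableSpace Ω] (P : Measure Ω)
    [IsFiniteMeasure P] : (p : ℕ) → (Ω → Fin p → ℝ) → (Fin p → ℝ) → (Fin p → ℝ)
  | 0, _, _ => Fin.elim0
  | p + 1, X, u =>
    let ζ : Fin p → ℝ := quantileTransform P p (fun ω => Fin.init (X ω)) (Fin.init u)
    Fin.snoc (α := fun _ => ℝ) ζ
      (leftQuantile
        (condDistrib (fun ω => X ω (Fin.last p)) (fun ω => Fin.init (X ω)) P ζ)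
        (u (Fin.last p)))

/-- `η^v_{Y|X}(u) = P(Y ≤ q_Y(v) | X = q_X(u))`, through the regular conditional distribution of
`Y` given `X`. -/
noncomputable def etaFun {Ω : Type*} [MeasurableSpace Ω] (P : Measure Ω) [IsFiniteMeasure P]
    {p : ℕ} (Y : Ω → ℝ) (X : Ω → Fin p → ℝ) (v : ℝ) (u : Fin p → ℝ) : ℝ :=
  (condDistrib Y X P (quantileTransform P p X u)).real (Iic (leftQuantile (P.map Y) v))

/-- The open unit cube `(0,1)^k`. -/
def unitCube (k : ℕ) : Set (Fin k → ℝ) :=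
  univ.pi fun _ => Ioo (0 : ℝ) 1

/-- The decreasing rearrangement `h* : (0,1) → ℝ` of a function `h` on `(0,1)^k`:
`h*(t) = sup {w | t ≤ λ^k(h ≥ w)}`. -/
noncomputable def decRearrangement {k : ℕ} (h : (Fin k → ℝ) → ℝ) (t : ℝ) : ℝ :=
  sSup {w : ℝ | t ≤ volume.real {u | u ∈ unitCube k ∧ w ≤ h u}}

/-- The Schur order `f ≺_S g` of integrable functions `f` on `(0,1)^d` and `g` on `(0,1)^d'`. -/
def SchurLE {d d' : ℕ} (f : (Fin d → ℝ) → ℝ) (g : (Fin d' → ℝ) → ℝ) : Prop :=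
  (∀ x ∈ Ioo (0 : ℝ) 1,
    ∫ t in (0 : ℝ)..x, decRearrangement f t ≤ ∫ t in (0 : ℝ)..x, decRearrangement g t) ∧
  ∫ t in (0 : ℝ)..1, decRearrangement f t = ∫ t in (0 : ℝ)..1, decRearrangement g t

lemma volume_unitCube (k : ℕ) : volume (unitCube k) = 1 := by
  simp [unitCube, volume_pi_pi]

/-- `decRearrangement h` is a decreasing rearrangement of `h`: it is decreasing on `(0,1)` and
`λ(h* ≥ w) = λ^k(h ≥ w)` for all real `w`. -/
theorem decRearrangement_spec {k : ℕ} (h : (Fin k → ℝ) → ℝ)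
    (hm : AEMeasurable h (volume.restrict (unitCube k))) :
    AntitoneOn (decRearrangement h) (Ioo 0 1) ∧
      ∀ w : ℝ, volume {t | t ∈ Ioo (0 : ℝ) 1 ∧ w ≤ decRearrangement h t} =
        volume {u | u ∈ unitCube k ∧ w ≤ h u} := by
  have hcm : MeasurableSet (unitCube k) := MeasurableSet.univ_pi fun _ => measurableSet_Ioo
  have : IsProbabilityMeasure (volume.restrict (unitCube k)) :=
    ⟨by rw [Measure.restrict_apply_univ, volume_unitCube]⟩
  set ν : Measure ℝ := (volume.restrict (unitCube k)).map h with hν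
  have : IsProbabilityMeasure ν := Measure.isProbabilityMeasure_map hm
  have hlev : ∀ w : ℝ, volume {u | u ∈ unitCube k ∧ w ≤ h u} = ν (Ici w) := fun w => by
    rw [hν, Measure.map_apply_of_aemeasurable hm measurableSet_Ici,
      Measure.restrict_apply' hcm, inter_comm]
    rfl
  have hanti : Antitone fun w => ν.real (Ici w) := fun a b hab =>
    measureReal_mono (Ici_subset_Ici.2 hab)
  have hcdf : ∀ w, ν.real (Ici w) ≥ 1 - cdf ν w := fun w => by
    have h1 : ν.real (Ici w) + ν.real (Iio w) = 1 := by
      rw [← compl_Ici, measureReal_add_measureReal_compl measurableSet_Ici]; simp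
    have h2 : ν.real (Iio w) ≤ cdf ν w := by
      rw [cdf_eq_real]; exact measureReal_mono Iio_subset_Iic_self
    linarith
  have hcdf' : ∀ w, ν.real (Ici w) ≤ 1 - cdf ν (w - 1) := fun w => by
    have h1 : ν.real (Iic (w - 1)) + ν.real (Ioi (w - 1)) = 1 := by
      rw [← compl_Iic, measureReal_add_measureReal_compl measurableSet_Iic]; simp
    have h2 : ν.real (Ici w) ≤ ν.real (Ioi (w - 1)) :=
      measureReal_mono fun x (hx : w ≤ x) => by simp only [mem_Ioi]; linarith
    rw [cdf_eq_real]; linarith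
  have hne : ∀ t < 1, {w : ℝ | t ≤ ν.real (Ici w)}.Nonempty := fun t ht => by
    obtain ⟨w, hw⟩ := ((tendsto_cdf_atBot ν).eventually (gt_mem_nhds (sub_pos.2 ht))).exists
    exact ⟨w, by have := hcdf w; simp only [mem_ofPred_eq]; linarith⟩
  have hbd : ∀ t > 0, BddAbove {w : ℝ | t ≤ ν.real (Ici w)} := fun t ht => by
    obtain ⟨w, hw⟩ := ((tendsto_cdf_atTop ν).eventually
      (lt_mem_nhds (show 1 - t < 1 by linarith))).exists
    refine ⟨w + 1, fun x (hx : t ≤ _) => ?_⟩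
    by_contra! hlt
    have h1 := hcdf' x
    have h2 : cdf ν w ≤ cdf ν (x - 1) := monotone_cdf ν (by linarith)
    linarith
  have hdef : ∀ t, decRearrangement h t = sSup {w : ℝ | t ≤ ν.real (Ici w)} := fun t => by
    simp only [decRearrangement, Measure.real, hlev]
  have hgal : ∀ t ∈ Ioo (0 : ℝ) 1, ∀ w, w ≤ decRearrangement h t ↔ t ≤ ν.real (Ici w) := by
    intro t ht w
    rw [hdef]
    refine ⟨fun hw => ?_, fun hw => le_csSup (hbd t ht.1) hw⟩
    have hlt : ∀ n : ℕ, t ≤ ν.real (Ici (w - 1 / ((n : ℝ) + 1))) := fun n => by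
      obtain ⟨x, hx, hwx⟩ := exists_lt_of_lt_csSup (hne t ht.2)
        (show w - 1 / ((n : ℝ) + 1) < _ from
          lt_of_lt_of_le (sub_lt_self _ (by positivity)) hw)
      exact le_trans hx (hanti hwx.le)
    have hI : ⋂ n : ℕ, Ici (w - 1 / ((n : ℝ) + 1)) = Ici w := by
      ext x
      simp only [mem_iInter, mem_Ici]
      refine ⟨fun hx => ?_, fun hx n => le_trans (sub_le_self _ (by positivity)) hx⟩
      have := (tendsto_one_div_add_atTop_nhds_zero_nat (𝕜 := ℝ)).const_sub w
      rw [sub_zero] at this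
      exact le_of_tendsto' this hx
    have hA : Antitone fun n : ℕ => Ici (w - 1 / ((n : ℝ) + 1)) := fun a b hab =>
      Ici_subset_Ici.2 (sub_le_sub_left (one_div_le_one_div_of_le (by positivity)
        (by gcongr)) _)
    have hT := tendsto_measure_iInter_atTop (μ := ν)
      (fun n : ℕ => (measurableSet_Ici (a := w - 1 / ((n : ℝ) + 1))).nullMeasurableSet) hA
      ⟨0, measure_ne_top _ _⟩
    rw [hI] at hT
    exact ge_of_tendsto' ((ENNReal.tendsto_toReal (measure_ne_top _ _)).comp hT) hlt
  refine ⟨fun s hs t ht hst => ?_, fun w => ?_⟩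
  · exact (hgal s hs _).2 (hst.trans ((hgal t ht _).1 le_rfl))
  · rw [hlev]
    have h1 : ν.real (Ici w) ≤ 1 := measureReal_le_one
    have h0 : 0 ≤ ν.real (Ici w) := measureReal_nonneg
    have hs : volume (Ioo (0 : ℝ) (ν.real (Ici w))) = ν (Ici w) := by
      rw [Real.volume_Ioo, sub_zero, ofReal_measureReal]
    have hl : volume (Ioc (0 : ℝ) (ν.real (Ici w))) = ν (Ici w) := by
      rw [Real.volume_Ioc, sub_zero, ofReal_measureReal]
    apply le_antisymm
    · rw [← hl]
      exact measure_mono fun t ht => ⟨ht.1.1, (hgal t ht.1 w).1 ht.2⟩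
    · rw [← hs]
      exact measure_mono fun t ht =>
        ⟨⟨ht.1, ht.2.trans_le h1⟩, (hgal t ⟨ht.1, ht.2.trans_le h1⟩ w).2 ht.2.le⟩

/-! Let `κ` be the conditional law of `Y` given `X`, and `q` the quantile function of `Y`. Both
statements are convex comparisons of conditional probabilities of half-lines.

For (i): the conditional survival probability is `1 - κ(Iio (q v))`, and `φ ↦ φ (1 - ·)` preserves
convexity. So (i) compares `κ(Iio (q v))` for every `v` (`convexOrderLE_condSurvival_iff`).

For (ii): the quantile transform carries the uniform law on the cube to the law of `X`
(`quantileTransform_law`). Hence `η^v` is distributed as `κ(Iic (q v))`, and by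
Hardy–Littlewood–Pólya (`Antitone.forall_setIntegral_le_iff`, `schurLE_iff`) the Schur order is the
convex order of these variables.

What remains is to pass between open half-lines at all `v` and closed half-lines at almost all `v`
(`forall_Iio_le_iff_ae_Iic_le`). Write `ν` for the law of `Y`, `g(v) = ν(Iio (q v))` and `G(v) =
ν(Iic (q v))`, so that `g(v) ≤ v ≤ G(v)`. Convex comparison forces equal means, so one side of the
equivalence gives `g = g'` everywhere and the other `G = G'` almost everywhere; monotonicity of
quantiles transfers each to the other. A convex `φ` is Lipschitz on `[0,1]`, so replacing one
half-line by a nested one changes the integral by at most a constant times the `ν`-mass between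
them. Levels just above `G(v)`, or just below `g(v)`, make this mass arbitrarily small on both sides
at once. -/

/-! ### Subgradients and Lipschitz bounds of convex functions. -/

theorem ConvexOn.exists_monotone_subgradient {φ : ℝ → ℝ} (hφ : ConvexOn ℝ univ φ) :
    ∃ c : ℝ → ℝ, Monotone c ∧ ∀ x y, φ x + c x * (y - x) ≤ φ y := by
  refine ⟨fun x => derivWithin φ (Ioi x) x, fun x y hxy => ?_, fun x y => ?_⟩
  · exact hφ.monotoneOn_rightDeriv (by simp) (by simp) hxy
  · rcases lt_trichotomy x y with h | rfl | h
    · have := hφ.rightDeriv_le_slope_of_mem_interior (x := x) (y := y) (by simp) (by simp) h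
      rw [slope_def_field, le_div_iff₀ (by linarith)] at this
      linarith
    · simp
    · have h1 := hφ.slope_le_leftDeriv_of_mem_interior (x := y) (y := x) (by simp) (by simp) h
      have h2 := hφ.leftDeriv_le_rightDeriv_of_mem_interior (x := x) (by simp)
      have := h1.trans h2
      rw [slope_def_field, div_le_iff₀ (by linarith)] at this
      linarith

theorem ConvexOn.continuous_real {φ : ℝ → ℝ} (hφ : ConvexOn ℝ univ φ) : Continuous φ :=
  hφ.locallyLipschitz.continuous

/-- Subgradients at points of `[0,1]` lie between those at `0` and `1`, by monotonicity. -/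
theorem ConvexOn.exists_abs_sub_le {φ : ℝ → ℝ} (hφ : ConvexOn ℝ univ φ) :
    ∃ L : ℝ, 0 ≤ L ∧ ∀ x ∈ Icc (0 : ℝ) 1, ∀ y ∈ Icc (0 : ℝ) 1, |φ x - φ y| ≤ L * |x - y| := by
  obtain ⟨c, hc, hs⟩ := hφ.exists_monotone_subgradient
  have key : ∀ x ∈ Icc (0 : ℝ) 1, ∀ y ∈ Icc (0 : ℝ) 1,
      φ x - φ y ≤ max |c 0| |c 1| * |x - y| := fun x hx y hy => by
    have h1 := hs x y
    have h2 : |c x| ≤ max |c 0| |c 1| := by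
      refine abs_le_max_abs_abs (hc hx.1) (hc hx.2)
    calc φ x - φ y ≤ c x * (x - y) := by linarith
      _ ≤ |c x * (x - y)| := le_abs_self _
      _ = |c x| * |x - y| := abs_mul _ _
      _ ≤ _ := by gcongr
  refine ⟨max |c 0| |c 1|, by positivity, fun x hx y hy => ?_⟩
  rw [abs_le]
  have h1 := key x hx y hy
  have h2 := key y hy x hx
  rw [abs_sub_comm] at h2
  constructor <;> linarith

theorem integrable_of_forall_mem_Icc {α : Type*} [MeasurableSpace α] {μ : Measure α}
    [IsFiniteMeasure μ] {f : α → ℝ} (hf : AEStronglyMeasurable f μ) {a b : ℝ}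
    (h : ∀ᵐ x ∂μ, f x ∈ Icc a b) : Integrable f μ :=
  Integrable.of_bound hf (max |a| |b|) (h.mono fun _ hx => abs_le_max_abs_abs hx.1 hx.2)

/-! ### The Hardy–Littlewood–Pólya theorem on the unit interval. -/

/-- Superlevel sets in `(0,1)` of a decreasing function are initial intervals. -/
theorem Antitone.exists_superlevel_ae_eq {d : ℝ → ℝ} (hd : Antitone d) (s : ℝ) :
    ∃ x ∈ Icc (0 : ℝ) 1, (Ioo 0 1 ∩ {t | s < d t} : Set ℝ) =ᵐ[volume] Ioc 0 x := by
  -- The endpoint is the supremum of `E`; inserting `0` makes it `0` when `E` is empty.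
  set E : Set ℝ := Ioo 0 1 ∩ {t | s < d t}
  have hb : BddAbove (insert 0 E) := ⟨1, by
    rintro t (rfl | ht)
    · exact zero_le_one
    · exact ht.1.2.le⟩
  have h0 : 0 ≤ sSup (insert 0 E) := le_csSup hb (mem_insert _ _)
  have h1 : sSup (insert 0 E) ≤ 1 := csSup_le (insert_nonempty _ _) (by
    rintro t (rfl | ht)
    · exact zero_le_one
    · exact ht.1.2.le)
  refine ⟨_, ⟨h0, h1⟩, ?_⟩
  have hsub : E ⊆ Ioc 0 (sSup (insert 0 E)) := fun t ht =>
    ⟨ht.1.1, le_csSup hb (mem_insert_of_mem _ ht)⟩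
  have hsup : Ioo 0 (sSup (insert 0 E)) ⊆ E := fun t ht => by
    obtain ⟨r, hr, htr⟩ := exists_lt_of_lt_csSup (insert_nonempty _ _) ht.2
    rcases hr with rfl | hr
    · exact absurd ht.1 htr.not_gt
    · exact ⟨⟨ht.1, htr.trans hr.1.2⟩, lt_of_lt_of_le hr.2 (hd htr.le)⟩
  exact (hsub.eventuallyLE (l := ae volume)).antisymm
    (Ioo_ae_eq_Ioc.symm.le.trans hsup.eventuallyLE)

/-- A nonnegative decreasing weight preserves nonnegativity of all initial integrals. -/
theorem integral_antitone_mul_nonneg {d D : ℝ → ℝ} (hd : Antitone d) {M : ℝ}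
    (hdM : ∀ t, d t ∈ Icc 0 M) (hDm : Measurable D) {B : ℝ} (hDB : ∀ t, |D t| ≤ B)
    (hD : ∀ x ∈ Icc (0 : ℝ) 1, 0 ≤ ∫ t in Ioc 0 x, D t) :
    0 ≤ ∫ t in Ioo 0 1, d t * D t := by
  have hS : MeasurableSet {p : ℝ × ℝ | p.2 < d p.1} :=
    measurableSet_lt measurable_snd (hd.measurable.comp measurable_fst)
  -- Layer cake: `d t` is the integral over `s` of the indicator of `s < d t`. After Fubini, each
  -- level `s` contributes an initial integral of `D`.
  have hlayer : ∀ t, d t * D t = ∫ s in Ioc 0 M, {p : ℝ × ℝ | p.2 < d p.1}.indicator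
      (fun p => D p.1) (t, s) := fun t => by
    have : (fun s => {p : ℝ × ℝ | p.2 < d p.1}.indicator (fun p => D p.1) (t, s)) =
        (Iio (d t)).indicator fun _ => D t := by
      ext s; simp [indicator]
    rw [this, integral_indicator measurableSet_Iio, setIntegral_const]
    have h2 : (volume.restrict (Ioc 0 M)).real (Iio (d t)) = d t := by
      rw [measureReal_restrict_apply measurableSet_Iio]
      have : Iio (d t) ∩ Ioc 0 M = Ioo 0 (d t) := by
        ext s
        simp only [mem_inter_iff, mem_Iio, mem_Ioc, mem_Ioo]
        exact ⟨fun h => ⟨h.2.1, h.1⟩, fun h => ⟨h.2, h.1, h.2.le.trans (hdM t).2⟩⟩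
      rw [this, Real.volume_real_Ioo_of_le (hdM t).1, sub_zero]
    rw [h2, smul_eq_mul]
  simp_rw [hlayer]
  have : IsFiniteMeasure ((volume.restrict (Ioo (0 : ℝ) 1)).prod
    (volume.restrict (Ioc (0 : ℝ) M))) := inferInstance
  rw [integral_integral_swap]
  · refine integral_nonneg fun s => ?_
    have : (fun t => {p : ℝ × ℝ | p.2 < d p.1}.indicator (fun p => D p.1) (t, s)) =
        {t | s < d t}.indicator D := by
      ext t; simp [indicator]
    simp only [Pi.zero_apply, this]
    have hm : MeasurableSet {t | s < d t} := measurableSet_lt measurable_const hd.measurable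
    rw [integral_indicator hm, Measure.restrict_restrict hm, inter_comm]
    obtain ⟨x, hx, hE⟩ := hd.exists_superlevel_ae_eq s
    rw [setIntegral_congr_set hE]
    exact hD x hx
  · refine Integrable.of_bound (C := B)
      ((hDm.comp measurable_fst).indicator hS).aestronglyMeasurable (ae_of_all _ fun p => ?_)
    exact (norm_indicator_le_norm_self (fun p : ℝ × ℝ => D p.1) p).trans (hDB _)

/-- The Hardy–Littlewood–Pólya characterization of the convex order, for decreasing functions on
the unit interval. -/
theorem Antitone.forall_setIntegral_le_iff {f g : ℝ → ℝ} (hf : Antitone f) (hg : Antitone g)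
    (hf1 : ∀ t, f t ∈ Icc (0 : ℝ) 1) (hg1 : ∀ t, g t ∈ Icc (0 : ℝ) 1) :
    ((∀ x ∈ Ioo (0 : ℝ) 1, ∫ t in (0 : ℝ)..x, f t ≤ ∫ t in (0 : ℝ)..x, g t) ∧
      ∫ t in (0 : ℝ)..1, f t = ∫ t in (0 : ℝ)..1, g t) ↔
    ∀ φ : ℝ → ℝ, ConvexOn ℝ univ φ →
      ∫ t in Ioo (0 : ℝ) 1, φ (f t) ≤ ∫ t in Ioo (0 : ℝ) 1, φ (g t) := by
  have hfi : ∀ s : Set ℝ, volume s ≠ ⊤ → IntegrableOn f s := fun s hs => by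
    have : IsFiniteMeasure (volume.restrict s) := isFiniteMeasure_restrict.2 hs
    exact integrable_of_forall_mem_Icc hf.measurable.aestronglyMeasurable (ae_of_all _ hf1)
  have hgi : ∀ s : Set ℝ, volume s ≠ ⊤ → IntegrableOn g s := fun s hs => by
    have : IsFiniteMeasure (volume.restrict s) := isFiniteMeasure_restrict.2 hs
    exact integrable_of_forall_mem_Icc hg.measurable.aestronglyMeasurable (ae_of_all _ hg1)
  have hcomp : ∀ {φ h : ℝ → ℝ}, ConvexOn ℝ univ φ → Measurable h → (∀ t, h t ∈ Icc (0 : ℝ) 1) →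
      ∀ s : Set ℝ, volume s ≠ ⊤ → IntegrableOn (fun t => φ (h t)) s := by
    intro φ h hφ hh h1 s hs
    have : IsFiniteMeasure (volume.restrict s) := isFiniteMeasure_restrict.2 hs
    obtain ⟨C, hC⟩ := isCompact_Icc.exists_bound_of_continuousOn
      (hφ.continuous_real.continuousOn (s := Icc (0 : ℝ) 1))
    exact Integrable.of_bound (hφ.continuous_real.measurable.comp hh).aestronglyMeasurable C
      (ae_of_all _ fun t => hC _ (h1 t))
  constructor
  · rintro ⟨hle, heq⟩ φ hφ
    obtain ⟨c, hc, hsub⟩ := hφ.exists_monotone_subgradient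
    have hDi : ∀ s : Set ℝ, volume s ≠ ⊤ → IntegrableOn (fun t => g t - f t) s :=
      fun s hs => (hgi s hs).sub (hfi s hs)
    have hD : ∀ x ∈ Icc (0 : ℝ) 1, 0 ≤ ∫ t in Ioc 0 x, (g t - f t) := by
      intro x hx
      rw [integral_sub (hgi _ (by simp)) (hfi _ (by simp)), ← intervalIntegral.integral_of_le hx.1,
        ← intervalIntegral.integral_of_le hx.1, sub_nonneg]
      rcases hx.1.eq_or_lt with rfl | h0
      · simp
      · rcases hx.2.eq_or_lt with rfl | h1
        · exact heq.le
        · exact hle x ⟨h0, h1⟩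
    have hD1 : ∫ t in Ioo 0 1, (g t - f t) = 0 := by
      rw [integral_sub (hgi _ (by simp)) (hfi _ (by simp)), ← integral_Ioc_eq_integral_Ioo,
        ← integral_Ioc_eq_integral_Ioo, ← intervalIntegral.integral_of_le zero_le_one,
        ← intervalIntegral.integral_of_le zero_le_one, heq, sub_self]
    have hbd : ∀ t, |g t - f t| ≤ 1 := fun t => by
      rw [abs_le]
      have := hf1 t
      have := hg1 t
      simp only [mem_Icc] at *
      constructor <;> linarith
    -- Subtracting `c 0` makes the weight nonnegative; it costs nothing because `g - f` has total
    -- integral zero.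
    have hw := integral_antitone_mul_nonneg (d := fun t => c (f t) - c 0) (D := fun t => g t - f t)
      (M := c 1 - c 0) (fun s t hst => sub_le_sub_right (hc (hf hst)) _)
      (fun t => ⟨sub_nonneg.2 (hc (hf1 t).1), sub_le_sub_right (hc (hf1 t).2) _⟩)
      (hg.measurable.sub hf.measurable) hbd hD
    have hci : IntegrableOn (fun t => c (f t) * (g t - f t)) (Ioo 0 1) := by
      refine Integrable.bdd_mul (c := max |c 0| |c 1|) (hDi _ (by simp))
        (hc.measurable.comp hf.measurable).aestronglyMeasurable (ae_of_all _ fun t => ?_)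
      exact abs_le_max_abs_abs (hc (hf1 t).1) (hc (hf1 t).2)
    have hw2 : 0 ≤ ∫ t in Ioo 0 1, c (f t) * (g t - f t) := by
      simp_rw [sub_mul] at hw
      rw [integral_sub hci ((hDi _ (by simp)).const_mul _), integral_const_mul, hD1] at hw
      simpa using hw
    have hmono : ∫ t in Ioo 0 1, (φ (f t) + c (f t) * (g t - f t)) ≤ ∫ t in Ioo 0 1, φ (g t) :=
      integral_mono ((hcomp hφ hf.measurable hf1 _ (by simp)).add hci)
        (hcomp hφ hg.measurable hg1 _ (by simp)) fun t => hsub _ _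
    rw [integral_add (hcomp hφ hf.measurable hf1 _ (by simp)) hci] at hmono
    linarith
  · intro h
    have hid := h id (convexOn_id convex_univ)
    have hneg := h (fun x => -x) (concaveOn_id convex_univ).neg
    refine ⟨fun x hx => ?_, ?_⟩
    -- Test with `max (y - k) 0`, where `k = g x`. As `g` decreases, the positive part is exact for
    -- `g` on `(0,x]` and vanishes beyond `x`, while for `f` it only dominates `f - k`.
    · set k := g x
      have hφ : ConvexOn ℝ univ fun y : ℝ => max (y - k) 0 :=
        ((convexOn_id convex_univ).sub (concaveOn_const k convex_univ)).sup
          (convexOn_const 0 convex_univ)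
      have hk := h _ hφ
      have hsplit : ∀ u : ℝ → ℝ, IntegrableOn u (Ioo 0 1) →
          ∫ t in Ioo 0 1, u t = (∫ t in Ioc 0 x, u t) + ∫ t in Ioo x 1, u t := fun u hu => by
        rw [← Ioc_union_Ioo_eq_Ioo hx.1.le hx.2] at hu ⊢
        exact setIntegral_union (disjoint_left.2 fun t ht ht' => ht.2.not_gt ht'.1) measurableSet_Ioo
          hu.left_of_union hu.right_of_union
      rw [hsplit _ (hcomp hφ hf.measurable hf1 _ (by simp)),
        hsplit _ (hcomp hφ hg.measurable hg1 _ (by simp))] at hk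
      have e1 : ∫ t in Ioc 0 x, max (g t - k) 0 = ∫ t in Ioc 0 x, (g t - k) :=
        setIntegral_congr_fun measurableSet_Ioc fun t ht => max_eq_left (sub_nonneg.2 (hg ht.2))
      have e2 : ∫ t in Ioo x 1, max (g t - k) 0 = 0 := by
        rw [setIntegral_congr_fun (g := fun _ => (0 : ℝ)) measurableSet_Ioo
          fun t ht => max_eq_right (sub_nonpos.2 (hg ht.1.le))]
        simp
      have e3 : 0 ≤ ∫ t in Ioo x 1, max (f t - k) 0 := integral_nonneg fun t => le_max_right _ _
      have e4 : ∫ t in Ioc 0 x, (f t - k) ≤ ∫ t in Ioc 0 x, max (f t - k) 0 :=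
        integral_mono ((hfi _ (by simp)).sub (integrableOn_const (by simp)))
          (hcomp hφ hf.measurable hf1 _ (by simp)) fun t => le_max_left _ _
      rw [integral_sub (hgi _ (by simp)) (integrableOn_const (by simp))] at e1
      rw [integral_sub (hfi _ (by simp)) (integrableOn_const (by simp))] at e4
      rw [intervalIntegral.integral_of_le hx.1.le, intervalIntegral.integral_of_le hx.1.le]
      linarith
    · rw [intervalIntegral.integral_of_le zero_le_one, intervalIntegral.integral_of_le zero_le_one,
        integral_Ioc_eq_integral_Ioo, integral_Ioc_eq_integral_Ioo]
      rw [integral_neg, integral_neg] at hneg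
      simp only [id] at hid
      linarith

/-! ### Quantile functions and the multivariate quantile transform. -/

/-- Right continuity of the distribution function means that the infimum is attained. -/
theorem leftQuantile_le_iff (ν : Measure ℝ) [IsProbabilityMeasure ν] {v : ℝ}
    (hv : v ∈ Ioo (0 : ℝ) 1) (y : ℝ) : leftQuantile ν v ≤ y ↔ v ≤ ν.real (Iic y) := by
  rw [← cdf_eq_real]
  have hne : {y : ℝ | v ≤ cdf ν y}.Nonempty := by
    obtain ⟨y, hy⟩ := ((tendsto_cdf_atTop ν).eventually (lt_mem_nhds hv.2)).exists
    exact ⟨y, hy.le⟩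
  have hbd : BddBelow {y : ℝ | v ≤ cdf ν y} := by
    obtain ⟨y, hy⟩ := ((tendsto_cdf_atBot ν).eventually (gt_mem_nhds hv.1)).exists
    refine ⟨y, fun z hz => ?_⟩
    by_contra! hlt
    exact (hy.trans_le hz).not_ge (monotone_cdf ν hlt.le)
  refine ⟨fun h => ?_, fun h => csInf_le hbd h⟩
  refine le_trans ?_ (monotone_cdf ν h)
  refine ge_of_tendsto (((cdf ν).right_continuous (leftQuantile ν v)).mono Ioi_subset_Ici_self)
    (eventually_nhdsWithin_of_forall fun z hz => ?_)
  obtain ⟨r, hr, hrz⟩ := exists_lt_of_csInf_lt hne hz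
  exact le_trans hr (monotone_cdf ν hrz.le)

theorem exists_measurable_eq_leftQuantile {α : Type*} [MeasurableSpace α] (κ : Kernel α ℝ)
    [IsMarkovKernel κ] : ∃ Q : α × ℝ → ℝ, Measurable Q ∧
      ∀ x, ∀ t ∈ Ioo (0 : ℝ) 1, Q (x, t) = leftQuantile (κ x) t := by
  classical
  -- The Galois property describes sublevel sets only for levels in `(0,1)`; elsewhere the value is
  -- set to `0` to keep joint measurability.
  refine ⟨fun p => if p.2 ∈ Ioo (0 : ℝ) 1 then leftQuantile (κ p.1) p.2 else 0, ?_,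
    fun x t ht => if_pos ht⟩
  refine measurable_of_Iic fun y => ?_
  have hI : MeasurableSet {p : α × ℝ | p.2 ∈ Ioo (0 : ℝ) 1} := measurable_snd measurableSet_Ioo
  have hle : MeasurableSet {p : α × ℝ | p.2 ≤ (κ p.1).real (Iic y)} :=
    measurableSet_le measurable_snd
      (((κ.measurable_coe measurableSet_Iic).ennreal_toReal).comp measurable_fst)
  have : (fun p : α × ℝ => if p.2 ∈ Ioo (0 : ℝ) 1 then leftQuantile (κ p.1) p.2 else 0) ⁻¹' Iic y =
      ({p : α × ℝ | p.2 ∈ Ioo (0 : ℝ) 1} ∩ {p | p.2 ≤ (κ p.1).real (Iic y)}) ∪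
        ({p : α × ℝ | p.2 ∈ Ioo (0 : ℝ) 1}ᶜ ∩ {_p | 0 ≤ y}) := by
    ext p
    by_cases hp : p.2 ∈ Ioo (0 : ℝ) 1
    · simp only [mem_preimage, mem_union, mem_inter_iff, mem_compl_iff, mem_ofPred_eq, hp, if_true,
        mem_Iic, leftQuantile_le_iff (κ p.1) hp y, true_and, not_true, false_and, or_false]
    · simp only [mem_preimage, mem_union, mem_inter_iff, mem_compl_iff, mem_ofPred_eq, hp, if_false,
        mem_Iic, not_false_eq_true, true_and, false_and, false_or]
  rw [this]
  exact (hI.inter hle).union (hI.compl.inter (MeasurableSet.const _))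

theorem volume_restrict_Ioo_isProbabilityMeasure :
    IsProbabilityMeasure (volume.restrict (Ioo (0 : ℝ) 1)) := ⟨by simp⟩

theorem volume_restrict_unitCube_isProbabilityMeasure (k : ℕ) :
    IsProbabilityMeasure (volume.restrict (unitCube k)) :=
  ⟨by rw [Measure.restrict_apply_univ, volume_unitCube]⟩

theorem measurableSet_unitCube (k : ℕ) : MeasurableSet (unitCube k) :=
  MeasurableSet.univ_pi fun _ => measurableSet_Ioo

/-- The inverse transform: the quantile function pushes the uniform distribution to `ν`. -/
theorem map_of_eq_leftQuantile (ν : Measure ℝ) [IsProbabilityMeasure ν] {Q : ℝ → ℝ}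
    (hQ : Measurable Q) (hQe : ∀ t ∈ Ioo (0 : ℝ) 1, Q t = leftQuantile ν t) :
    (volume.restrict (Ioo (0 : ℝ) 1)).map Q = ν := by
  have := volume_restrict_Ioo_isProbabilityMeasure
  have : IsProbabilityMeasure ((volume.restrict (Ioo (0 : ℝ) 1)).map Q) :=
    Measure.isProbabilityMeasure_map hQ.aemeasurable
  refine Measure.ext_of_Iic _ _ fun y => ?_
  rw [Measure.map_apply hQ measurableSet_Iic, Measure.restrict_apply (hQ measurableSet_Iic)]
  have h1 : ν.real (Iic y) ≤ 1 := measureReal_le_one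
  have he : Q ⁻¹' Iic y ∩ Ioo 0 1 = Ioo 0 1 ∩ Iic (ν.real (Iic y)) := by
    ext t
    simp only [mem_inter_iff, mem_preimage, mem_Iic, and_comm (b := t ∈ Ioo (0 : ℝ) 1)]
    refine and_congr_right fun ht => ?_
    rw [hQe t ht, leftQuantile_le_iff ν ht]
  rw [he, ← ofReal_measureReal (μ := ν)]
  apply le_antisymm
  · calc _ ≤ volume (Ioc 0 (ν.real (Iic y))) := measure_mono fun t ht => ⟨ht.1.1, ht.2⟩
      _ = _ := by rw [Real.volume_Ioc, sub_zero]
  · calc _ = volume (Ioo 0 (ν.real (Iic y))) := by rw [Real.volume_Ioo, sub_zero]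
      _ ≤ volume (Ioo 0 1 ∩ Iic (ν.real (Iic y))) :=
        measure_mono fun t ht => ⟨⟨ht.1, ht.2.trans_le h1⟩, ht.2.le⟩

/-- The inverse transform with a random parameter. -/
theorem map_prod_leftQuantile {α β : Type*} [MeasurableSpace α] [MeasurableSpace β]
    (μ : Measure β) [IsProbabilityMeasure μ] (κ : Kernel α ℝ) [IsMarkovKernel κ] {T : β → α}
    (hT : Measurable T) {Q : α × ℝ → ℝ} (hQ : Measurable Q)
    (hQe : ∀ x, ∀ t ∈ Ioo (0 : ℝ) 1, Q (x, t) = leftQuantile (κ x) t) :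
    (μ.prod (volume.restrict (Ioo (0 : ℝ) 1))).map (fun p => (T p.1, Q (T p.1, p.2))) =
      (μ.map T) ⊗ₘ κ := by
  have : IsProbabilityMeasure (μ.map T) := Measure.isProbabilityMeasure_map hT.aemeasurable
  have hm : Measurable fun p : β × ℝ => (T p.1, Q (T p.1, p.2)) := by fun_prop
  ext B hB
  rw [Measure.map_apply hm hB, Measure.prod_apply (hm hB), Measure.compProd_apply hB,
    lintegral_map (Kernel.measurable_kernel_prodMk_left hB) hT]
  refine lintegral_congr fun u => ?_
  have hQu : Measurable fun t => Q (T u, t) := by fun_prop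
  -- With `u` fixed this is the one-dimensional inverse transform for `κ (T u)`.
  rw [← map_of_eq_leftQuantile (κ (T u)) hQu (hQe _),
    Measure.map_apply hQu (measurable_prodMk_left hB)]
  rfl

theorem measurePreserving_unitCube_succ (p : ℕ) :
    MeasurePreserving (MeasurableEquiv.piFinSuccAbove (fun _ : Fin (p + 1) => ℝ) (Fin.last p))
      (volume.restrict (unitCube (p + 1)))
      ((volume.restrict (Ioo (0 : ℝ) 1)).prod (volume.restrict (unitCube p))) := by
  have h := volume_preserving_piFinSuccAbove (fun _ : Fin (p + 1) => ℝ) (Fin.last p)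
  have := h.restrict_preimage (measurableSet_Ioo.prod (measurableSet_unitCube p)
    : MeasurableSet (Ioo (0 : ℝ) 1 ×ˢ unitCube p))
  rw [Measure.volume_eq_prod, ← Measure.prod_restrict] at this
  have hset : unitCube (p + 1) =
      MeasurableEquiv.piFinSuccAbove (fun _ : Fin (p + 1) => ℝ) (Fin.last p) ⁻¹'
        (Ioo (0 : ℝ) 1 ×ˢ unitCube p) := by
    ext u
    simp [unitCube, Fin.forall_fin_succ', MeasurableEquiv.piFinSuccAbove, Fin.insertNthEquiv,
      and_comm, Fin.init_def]
  rw [hset]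
  exact this

/-- The multivariate quantile transform pushes the uniform distribution on the unit cube to the
distribution of `X`. -/
theorem quantileTransform_law {Ω : Type*} [MeasurableSpace Ω] (P : Measure Ω)
    [IsProbabilityMeasure P] : ∀ (p : ℕ) (X : Ω → Fin p → ℝ), Measurable X →
    ∃ T : (Fin p → ℝ) → Fin p → ℝ, Measurable T ∧
      EqOn (quantileTransform P p X) T (unitCube p) ∧
      (volume.restrict (unitCube p)).map T = P.map X
  | 0, X, hX => by
    have := volume_restrict_unitCube_isProbabilityMeasure 0
    have : IsProbabilityMeasure (P.map X) := Measure.isProbabilityMeasure_map hX.aemeasurable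
    refine ⟨id, measurable_id, fun u _ => Subsingleton.elim _ _, ?_⟩
    rw [Measure.map_id]
    ext s hs
    rcases s.eq_empty_or_nonempty with rfl | hne
    · simp
    · rw [Subsingleton.eq_univ_of_nonempty hne, measure_univ, measure_univ]
  | p + 1, X, hX => by
    have hXi : Measurable fun ω => (Fin.init (X ω) : Fin p → ℝ) :=
      measurable_pi_iff.2 fun i => (measurable_pi_apply _).comp hX
    have hXl : Measurable fun ω => X ω (Fin.last p) := (measurable_pi_apply _).comp hX
    obtain ⟨T, hT, hTe, hTl⟩ := quantileTransform_law P p _ hXi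
    set κ := condDistrib (fun ω => X ω (Fin.last p)) (fun ω => (Fin.init (X ω) : Fin p → ℝ)) P
    obtain ⟨Q, hQ, hQe⟩ := exists_measurable_eq_leftQuantile κ
    have := volume_restrict_unitCube_isProbabilityMeasure p
    have hlaw := map_prod_leftQuantile (volume.restrict (unitCube p)) κ hT hQ hQe
    rw [hTl, compProd_map_condDistrib hXl.aemeasurable] at hlaw
    -- `e` puts the last coordinate first, whereas `⊗ₘ` puts the conditioning variable first; hence
    -- the swaps below.
    set e := MeasurableEquiv.piFinSuccAbove (fun _ : Fin (p + 1) => ℝ) (Fin.last p) with he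
    have hesymm : ∀ (a : ℝ) (z : Fin p → ℝ), e.symm (a, z) = Fin.snoc (α := fun _ => ℝ) z a := by
      intro a z
      simp [he, MeasurableEquiv.piFinSuccAbove, Fin.insertNthEquiv, Fin.insertNth_last']
    have hcube := measurePreserving_unitCube_succ p
    set S : (Fin p → ℝ) × ℝ → (Fin p → ℝ) × ℝ := fun w => (T w.1, Q (T w.1, w.2)) with hSdef
    have hS : Measurable S := by fun_prop
    refine ⟨fun u => e.symm (S (e u).swap).swap, by fun_prop, fun u hu => ?_, ?_⟩
    · have hui : Fin.init u ∈ unitCube p := fun i _ => hu (Fin.castSucc i) (mem_univ _)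
      have heu : e u = (u (Fin.last p), Fin.init u) := by
        refine (e.symm_apply_eq.1 ?_).symm
        rw [hesymm, Fin.snoc_init_self]
      simp only [heu, hSdef, Prod.swap, hesymm]
      rw [← hTe hui, hQe _ _ (hu (Fin.last p) (mem_univ _))]
      rfl
    · have hsw : ((volume.restrict (Ioo (0 : ℝ) 1)).prod (volume.restrict (unitCube p))).map
          Prod.swap = (volume.restrict (unitCube p)).prod (volume.restrict (Ioo (0 : ℝ) 1)) :=
        Measure.prod_swap
      have : (fun u => e.symm (S (e u).swap).swap) = (e.symm ∘ Prod.swap) ∘ (S ∘ Prod.swap) ∘ e :=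
        rfl
      rw [this, ← Measure.map_map (g := e.symm ∘ Prod.swap) (by fun_prop) (by fun_prop),
        ← Measure.map_map (g := S ∘ Prod.swap) (by fun_prop) (by fun_prop), hcube.map_eq,
        ← Measure.map_map hS measurable_swap, hsw, hlaw,
        Measure.map_map (by fun_prop) (by fun_prop)]
      congr 1
      funext ω
      simp only [Function.comp, Prod.swap, hesymm, Fin.snoc_init_self]

/-! ### The Schur order as a convex order. -/

/-- On the unit interval, the decreasing rearrangement of a `[0,1]`-valued function agrees with a
decreasing `[0,1]`-valued function that is equidistributed with it. -/
theorem exists_antitone_eqOn_decRearrangement {k : ℕ} {h : (Fin k → ℝ) → ℝ}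
    (hm : AEMeasurable h (volume.restrict (unitCube k))) (h1 : ∀ u, h u ∈ Icc (0 : ℝ) 1) :
    ∃ f : ℝ → ℝ, Antitone f ∧ (∀ t, f t ∈ Icc (0 : ℝ) 1) ∧
      EqOn (decRearrangement h) f (Ioo 0 1) ∧
      (volume.restrict (Ioo (0 : ℝ) 1)).map f = (volume.restrict (unitCube k)).map h := by
  have := volume_restrict_Ioo_isProbabilityMeasure
  have := volume_restrict_unitCube_isProbabilityMeasure k
  obtain ⟨hanti, hlev⟩ := decRearrangement_spec h hm
  have hmem : ∀ t ∈ Ioo (0 : ℝ) 1, decRearrangement h t ∈ Icc (0 : ℝ) 1 := fun t ht => by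
    have hub : ∀ w ∈ {w : ℝ | t ≤ volume.real {u | u ∈ unitCube k ∧ w ≤ h u}}, w ≤ 1 := by
      intro w hw
      by_contra! hlt
      have : {u | u ∈ unitCube k ∧ w ≤ h u} = ∅ := by
        ext u
        simpa using fun _ => (h1 u).2.trans_lt hlt
      simp only [mem_ofPred_eq, this, measureReal_empty] at hw
      exact hw.not_gt ht.1
    have h0 : (0 : ℝ) ∈ {w : ℝ | t ≤ volume.real {u | u ∈ unitCube k ∧ w ≤ h u}} := by
      have : {u | u ∈ unitCube k ∧ 0 ≤ h u} = unitCube k := by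
        ext u
        simpa using fun _ => (h1 u).1
      simp only [mem_ofPred_eq, this, Measure.real, volume_unitCube]
      simpa using ht.2.le
    exact ⟨le_csSup ⟨1, hub⟩ h0, csSup_le ⟨0, h0⟩ hub⟩
  obtain ⟨f₀, hf₀, hfe⟩ := hanti.exists_antitone_extension
    ⟨0, by rintro _ ⟨t, ht, rfl⟩; exact (hmem t ht).1⟩
    ⟨1, by rintro _ ⟨t, ht, rfl⟩; exact (hmem t ht).2⟩
  -- Clamping keeps the extension `[0,1]`-valued on the whole line without changing it on `(0,1)`.
  have hf : Antitone fun t => max 0 (min 1 (f₀ t)) := fun s t hst =>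
    max_le_max le_rfl (min_le_min le_rfl (hf₀ hst))
  have he : EqOn (decRearrangement h) (fun t => max 0 (min 1 (f₀ t))) (Ioo 0 1) := fun t ht => by
    have := hmem t ht
    simp only [← hfe ht, min_eq_right this.2, max_eq_right this.1]
  refine ⟨_, hf, fun t => ⟨le_max_left _ _, max_le zero_le_one (min_le_left _ _)⟩, he, ?_⟩
  have := Measure.isProbabilityMeasure_map (μ := volume.restrict (Ioo (0 : ℝ) 1))
    hf.measurable.aemeasurable
  have := Measure.isProbabilityMeasure_map hm
  refine Measure.ext_of_Ici _ _ fun w => ?_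
  rw [Measure.map_apply hf.measurable measurableSet_Ici,
    Measure.restrict_apply (hf.measurable measurableSet_Ici),
    Measure.map_apply_of_aemeasurable hm measurableSet_Ici,
    Measure.restrict_apply' (measurableSet_unitCube k), inter_comm _ (unitCube k)]
  refine Eq.trans ?_ (hlev w)
  congr 1
  ext t
  simp only [mem_inter_iff, mem_preimage, mem_Ici, mem_ofPred_eq, and_comm (b := t ∈ Ioo (0 : ℝ) 1)]
  exact and_congr_right fun ht => by rw [he ht]

/-- The Schur order of `[0,1]`-valued functions is the convex order of their distributions. -/
theorem schurLE_iff {d d' : ℕ} {f : (Fin d → ℝ) → ℝ} {g : (Fin d' → ℝ) → ℝ}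
    (hf : AEMeasurable f (volume.restrict (unitCube d))) (hf1 : ∀ u, f u ∈ Icc (0 : ℝ) 1)
    (hg : AEMeasurable g (volume.restrict (unitCube d'))) (hg1 : ∀ u, g u ∈ Icc (0 : ℝ) 1) :
    SchurLE f g ↔
      ConvexOrderLE (volume.restrict (unitCube d)) f (volume.restrict (unitCube d')) g := by
  obtain ⟨F, hF, hF1, hFe, hFl⟩ := exists_antitone_eqOn_decRearrangement hf hf1
  obtain ⟨G, hG, hG1, hGe, hGl⟩ := exists_antitone_eqOn_decRearrangement hg hg1
  have hcongr : ∀ {u v : ℝ → ℝ}, EqOn u v (Ioo 0 1) → ∀ x ∈ Icc (0 : ℝ) 1,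
      ∫ t in (0 : ℝ)..x, u t = ∫ t in (0 : ℝ)..x, v t := by
    intro u v huv x hx
    rw [intervalIntegral.integral_of_le hx.1, intervalIntegral.integral_of_le hx.1,
      integral_Ioc_eq_integral_Ioo, integral_Ioc_eq_integral_Ioo]
    exact setIntegral_congr_fun measurableSet_Ioo fun t ht => huv ⟨ht.1, ht.2.trans_le hx.2⟩
  have hS : SchurLE f g ↔ ((∀ x ∈ Ioo (0 : ℝ) 1, ∫ t in (0 : ℝ)..x, F t ≤ ∫ t in (0 : ℝ)..x, G t) ∧
      ∫ t in (0 : ℝ)..1, F t = ∫ t in (0 : ℝ)..1, G t) := by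
    refine and_congr (forall₂_congr fun x hx => ?_) ?_
    · rw [hcongr hFe x (Ioo_subset_Icc_self hx), hcongr hGe x (Ioo_subset_Icc_self hx)]
    · rw [hcongr hFe 1 (by simp), hcongr hGe 1 (by simp)]
  rw [hS, hF.forall_setIntegral_le_iff hG hF1 hG1]
  refine forall₂_congr fun φ hφ => ?_
  have hc := hφ.continuous_real
  rw [← integral_map hF.measurable.aemeasurable (f := φ) hc.aestronglyMeasurable,
    ← integral_map hG.measurable.aemeasurable (f := φ) hc.aestronglyMeasurable, hFl, hGl,
    integral_map hf hc.aestronglyMeasurable, integral_map hg hc.aestronglyMeasurable]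

/-! ### Masses of open and closed half-lines at quantiles. -/

theorem measureReal_Iio_le_of_forall_Iic {ν : Measure ℝ} [IsProbabilityMeasure ν] {a w : ℝ}
    (h : ∀ y < a, ν.real (Iic y) ≤ w) : ν.real (Iio a) ≤ w := by
  obtain ⟨u, hu, hua, hut⟩ := exists_seq_strictMono_tendsto a
  have hU : ⋃ n, Iic (u n) = Iio a := by
    ext x
    simp only [mem_iUnion, mem_Iic, mem_Iio]
    exact ⟨fun ⟨n, hn⟩ => hn.trans_lt (hua n),
      fun hx => (hut.eventually (lt_mem_nhds hx)).exists.imp fun _ => le_of_lt⟩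
  have hT := tendsto_measure_iUnion_atTop (μ := ν) (s := fun n => Iic (u n))
    fun m n hmn => Iic_subset_Iic.2 (hu.monotone hmn)
  rw [hU] at hT
  exact le_of_tendsto' ((ENNReal.tendsto_toReal (measure_ne_top _ _)).comp hT) fun n => h _ (hua n)

theorem le_measureReal_Iic_leftQuantile (ν : Measure ℝ) [IsProbabilityMeasure ν] {v : ℝ}
    (hv : v ∈ Ioo (0 : ℝ) 1) : v ≤ ν.real (Iic (leftQuantile ν v)) :=
  (leftQuantile_le_iff ν hv _).1 le_rfl

theorem measureReal_Iio_leftQuantile_le (ν : Measure ℝ) [IsProbabilityMeasure ν] {v : ℝ}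
    (hv : v ∈ Ioo (0 : ℝ) 1) : ν.real (Iio (leftQuantile ν v)) ≤ v :=
  measureReal_Iio_le_of_forall_Iic fun y hy =>
    le_of_not_ge fun h => hy.not_ge ((leftQuantile_le_iff ν hv y).2 h)

theorem leftQuantile_lt_iff_measureReal_lt (ν : Measure ℝ) [IsProbabilityMeasure ν] {v w : ℝ}
    (hv : v ∈ Ioo (0 : ℝ) 1) :
    leftQuantile ν w < leftQuantile ν v ↔ ν.real (Iic (leftQuantile ν w)) < v := by
  rw [← not_le, ← not_le, leftQuantile_le_iff ν hv]

/-- `G(w) < v` says `q w < q v`, so `w ≤ G(w) ≤ g(v)`. Together with the near converse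
`measureReal_Iic_leftQuantile_lt`, this lets `g` and `G` determine each other up to boundary cases.
-/
theorem le_measureReal_Iio_leftQuantile (ν : Measure ℝ) [IsProbabilityMeasure ν] {v w : ℝ}
    (hv : v ∈ Ioo (0 : ℝ) 1) (hw : w ∈ Ioo (0 : ℝ) 1)
    (h : ν.real (Iic (leftQuantile ν w)) < v) : w ≤ ν.real (Iio (leftQuantile ν v)) :=
  (le_measureReal_Iic_leftQuantile ν hw).trans <| measureReal_mono <|
    Iic_subset_Iio.2 ((leftQuantile_lt_iff_measureReal_lt ν hv).2 h)

theorem measureReal_Iic_leftQuantile_lt (ν : Measure ℝ) [IsProbabilityMeasure ν] {v w : ℝ}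
    (hv : v ∈ Ioo (0 : ℝ) 1) (hw : w ∈ Ioo (0 : ℝ) 1)
    (h : w < ν.real (Iio (leftQuantile ν v))) : ν.real (Iic (leftQuantile ν w)) < v := by
  rw [← leftQuantile_lt_iff_measureReal_lt ν hv]
  by_contra! hle
  exact h.not_ge ((measureReal_mono (Iio_subset_Iio hle)).trans
    (measureReal_Iio_leftQuantile_le ν hw))

/-- A rational `r` strictly between `G(v)` and `G'(v)` satisfies `v ≤ g(r) = g'(r) ≤ v`, so every
exceptional `v` is a value of `g` at a rational. -/
theorem countable_measureReal_Iic_leftQuantile_lt {ν ν' : Measure ℝ} [IsProbabilityMeasure ν]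
    [IsProbabilityMeasure ν'] (h : ∀ v ∈ Ioo (0 : ℝ) 1,
      ν.real (Iio (leftQuantile ν v)) = ν'.real (Iio (leftQuantile ν' v))) :
    {v | v ∈ Ioo (0 : ℝ) 1 ∧
      ν.real (Iic (leftQuantile ν v)) < ν'.real (Iic (leftQuantile ν' v))}.Countable := by
  refine (countable_range fun r : ℚ => ν.real (Iio (leftQuantile ν r))).mono ?_
  rintro v ⟨hv, hlt⟩
  obtain ⟨r, hr1, hr2⟩ := exists_rat_btwn hlt
  have hr : (r : ℝ) ∈ Ioo (0 : ℝ) 1 :=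
    ⟨hv.1.trans_le ((le_measureReal_Iic_leftQuantile ν hv).trans hr1.le),
      hr2.trans_le measureReal_le_one⟩
  refine ⟨r, le_antisymm ?_ (le_measureReal_Iio_leftQuantile ν hr hv hr1)⟩
  simp only [h r hr]
  by_contra! hlt'
  exact hr2.not_gt (measureReal_Iic_leftQuantile_lt ν' hr hv hlt')

theorem exists_mem_Ioo_of_ae {p : ℝ → Prop} (h : ∀ᵐ v ∂(volume.restrict (Ioo (0 : ℝ) 1)), p v)
    {a b : ℝ} (ha : 0 ≤ a) (hb : b ≤ 1) (hab : a < b) : ∃ v ∈ Ioo a b, p v := by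
  have h' := ae_restrict_of_ae_restrict_of_subset (Ioo_subset_Ioo ha hb) h
  have : (ae (volume.restrict (Ioo a b))).NeBot := by
    rw [ae_neBot, Ne, Measure.restrict_eq_zero, Real.volume_Ioo]
    simpa using hab
  obtain ⟨v, hv, hp⟩ := ((ae_restrict_mem measurableSet_Ioo).and h').exists
  exact ⟨v, hv, hp⟩

/-- Otherwise some `w` strictly between `g'(v)` and `g(v)` has `G(w) = G'(w)`. Then `w < g(v)` gives
`G'(w) = G(w) < v`, hence `w ≤ g'(v)`, a contradiction. -/
theorem measureReal_Iio_leftQuantile_le_of_ae {ν ν' : Measure ℝ} [IsProbabilityMeasure ν]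
    [IsProbabilityMeasure ν'] (h : ∀ᵐ v ∂(volume.restrict (Ioo (0 : ℝ) 1)),
      ν.real (Iic (leftQuantile ν v)) = ν'.real (Iic (leftQuantile ν' v))) {v : ℝ}
    (hv : v ∈ Ioo (0 : ℝ) 1) :
    ν.real (Iio (leftQuantile ν v)) ≤ ν'.real (Iio (leftQuantile ν' v)) := by
  by_contra! hlt
  have h1 := (measureReal_Iio_leftQuantile_le ν hv).trans hv.2.le
  have h0 : 0 ≤ ν'.real (Iio (leftQuantile ν' v)) := measureReal_nonneg
  obtain ⟨w, hw, he⟩ := exists_mem_Ioo_of_ae h h0 h1 hlt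
  have hw1 : w ∈ Ioo (0 : ℝ) 1 := ⟨h0.trans_lt hw.1, hw.2.trans_le h1⟩
  have := measureReal_Iic_leftQuantile_lt ν hv hw1 hw.2
  rw [he] at this
  exact hw.1.not_ge (le_measureReal_Iio_leftQuantile ν' hv hw1 this)

/-! ### From open half-lines at all levels to closed ones at almost all levels. -/

theorem ProbabilityTheory.Kernel.measurable_real {α : Type*} [MeasurableSpace α] (κ : Kernel α ℝ)
    {A : Set ℝ} (hA : MeasurableSet A) :
    Measurable fun x => (κ x).real A :=
  (κ.measurable_coe hA).ennreal_toReal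

theorem integrable_convex_kernel {α : Type*} [MeasurableSpace α] (μ : Measure α)
    [IsFiniteMeasure μ] (κ : Kernel α ℝ) [IsMarkovKernel κ] {φ : ℝ → ℝ}
    (hφ : ConvexOn ℝ univ φ) {A : Set ℝ}
    (hA : MeasurableSet A) : Integrable (fun x => φ ((κ x).real A)) μ := by
  obtain ⟨C, hC⟩ := isCompact_Icc.exists_bound_of_continuousOn
    (hφ.continuous_real.continuousOn (s := Icc (0 : ℝ) 1))
  exact Integrable.of_bound
    (hφ.continuous_real.measurable.comp (κ.measurable_real hA)).aestronglyMeasurable C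
    (ae_of_all _ fun t => hC _ ⟨measureReal_nonneg, measureReal_le_one⟩)

theorem integral_kernel_real {α : Type*} [MeasurableSpace α] (μ : Measure α)
    (κ : Kernel α ℝ) [IsMarkovKernel κ] {A : Set ℝ} (hA : MeasurableSet A) :
    ∫ x, (κ x).real A ∂μ = (κ ∘ₘ μ).real A := by
  rw [Measure.real, Measure.bind_apply hA κ.aemeasurable]
  exact integral_toReal (κ.measurable_coe hA).aemeasurable (ae_of_all _ fun x => measure_lt_top _ _)

/-- Since `A ⊆ B`, the increments `κ x B - κ x A` are nonnegative, so the Lipschitz bound integrates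
to an unconditional mass. This makes the estimate independent of the conditioning structure. -/
theorem abs_integral_convex_kernel_sub_le {α : Type*} [MeasurableSpace α] (μ : Measure α)
    [IsFiniteMeasure μ] (κ : Kernel α ℝ) [IsMarkovKernel κ] {φ : ℝ → ℝ}
    (hφ : ConvexOn ℝ univ φ) {L : ℝ}
    (hL : ∀ x ∈ Icc (0 : ℝ) 1, ∀ y ∈ Icc (0 : ℝ) 1, |φ x - φ y| ≤ L * |x - y|) {A B : Set ℝ}
    (hA : MeasurableSet A) (hB : MeasurableSet B) (hAB : A ⊆ B) :
    |∫ x, φ ((κ x).real B) ∂μ - ∫ x, φ ((κ x).real A) ∂μ| ≤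
      L * ((κ ∘ₘ μ).real B - (κ ∘ₘ μ).real A) := by
  have hi : ∀ {S : Set ℝ}, MeasurableSet S → Integrable (fun x => (κ x).real S) μ := fun hS =>
    integrable_convex_kernel μ κ (φ := id) (convexOn_id convex_univ) hS
  rw [← integral_sub (integrable_convex_kernel μ κ hφ hB) (integrable_convex_kernel μ κ hφ hA),
    ← integral_kernel_real μ κ hA, ← integral_kernel_real μ κ hB, ← integral_sub (hi hB) (hi hA),
    ← integral_const_mul]
  refine abs_integral_le_integral_abs.trans (integral_mono_of_nonneg
    (ae_of_all _ fun _ => abs_nonneg _) (((hi hB).sub (hi hA)).const_mul _) (ae_of_all _ fun x => ?_))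
  have h := hL ((κ x).real B) ⟨measureReal_nonneg, measureReal_le_one⟩ ((κ x).real A)
    ⟨measureReal_nonneg, measureReal_le_one⟩
  rwa [abs_of_nonneg (a := (κ x).real B - _) (sub_nonneg.2 (measureReal_mono hAB))] at h

/-- Convex comparison of the conditional distribution functions at all left limits at quantiles is
the same as convex comparison at almost all quantiles. -/
theorem forall_Iio_le_iff_ae_Iic_le {α α' : Type*} [MeasurableSpace α] [MeasurableSpace α']
    (μ : Measure α) [IsProbabilityMeasure μ] (κ : Kernel α ℝ) [IsMarkovKernel κ]
    (μ' : Measure α') [IsProbabilityMeasure μ'] (κ' : Kernel α' ℝ) [IsMarkovKernel κ']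
    {q q' : ℝ → ℝ} (hq : q = leftQuantile (κ ∘ₘ μ)) (hq' : q' = leftQuantile (κ' ∘ₘ μ')) :
    (∀ v ∈ Ioo (0 : ℝ) 1, ∀ φ : ℝ → ℝ, ConvexOn ℝ univ φ →
      ∫ x, φ ((κ x).real (Iio (q v))) ∂μ ≤ ∫ x, φ ((κ' x).real (Iio (q' v))) ∂μ') ↔
    ∀ᵐ v ∂(volume.restrict (Ioo (0 : ℝ) 1)), ∀ φ : ℝ → ℝ, ConvexOn ℝ univ φ →
      ∫ x, φ ((κ x).real (Iic (q v))) ∂μ ≤ ∫ x, φ ((κ' x).real (Iic (q' v))) ∂μ' := by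
  set ν := κ ∘ₘ μ with hν
  set ν' := κ' ∘ₘ μ' with hν'
  have hmean : ∀ {A B : Set ℝ}, MeasurableSet A → MeasurableSet B →
      (∀ φ : ℝ → ℝ, ConvexOn ℝ univ φ →
        ∫ x, φ ((κ x).real A) ∂μ ≤ ∫ x, φ ((κ' x).real B) ∂μ') → ν.real A = ν'.real B := by
    intro A B hA hB h
    have h1 := h id (convexOn_id convex_univ)
    have h2 := h (fun x => -x) (concaveOn_id convex_univ).neg
    rw [integral_neg, integral_neg] at h2
    simp only [id] at h1
    rw [hν, hν', ← integral_kernel_real μ κ hA, ← integral_kernel_real μ' κ' hB]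
    linarith
  have hclose : ∀ {a b c d x y : ℝ} {L : ℝ}, 0 ≤ L → c ≤ d → |c - a| ≤ L * x →
      |d - b| ≤ L * x → x ≤ y → a ≤ b + 2 * L * y := by
    intro a b c d x y L hL hcd h1 h2 hxy
    rw [abs_le] at h1 h2
    nlinarith [mul_le_mul_of_nonneg_left hxy hL]
  have hlim : ∀ {a b L δ : ℝ}, 0 ≤ L → 0 < δ → (∀ ε, 0 < ε → ε ≤ δ → a ≤ b + 2 * L * ε) →
      a ≤ b := by
    intro a b L δ hL hδ h
    refine le_of_forall_pos_le_add fun ε hε => ?_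
    have hpos : 0 < ε / (2 * L + 1) := by positivity
    refine (h (min δ (ε / (2 * L + 1))) (lt_min hδ hpos) (min_le_left _ _)).trans ?_
    have h1 : 2 * L * min δ (ε / (2 * L + 1)) ≤ 2 * L * (ε / (2 * L + 1)) := by
      gcongr
      exact min_le_right _ _
    have h2 : (2 * L + 1) * (ε / (2 * L + 1)) = ε := by field_simp
    linarith
  constructor
  · intro h
    have hg : ∀ v ∈ Ioo (0 : ℝ) 1,
        ν.real (Iio (leftQuantile ν v)) = ν'.real (Iio (leftQuantile ν' v)) := fun v hv => by
      rw [← hq, ← hq']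
      exact hmean measurableSet_Iio measurableSet_Iio (h v hv)
    have hc1 := countable_measureReal_Iic_leftQuantile_lt hg
    have hc2 := countable_measureReal_Iic_leftQuantile_lt fun v hv => (hg v hv).symm
    rw [ae_restrict_iff' measurableSet_Ioo]
    filter_upwards [hc1.ae_notMem volume, hc2.ae_notMem volume] with v hv1 hv2 hv φ hφ
    have hG : ν.real (Iic (q v)) = ν'.real (Iic (q' v)) := by
      rw [hq, hq']
      exact le_antisymm (le_of_not_gt fun hlt => hv2 ⟨hv, hlt⟩)
        (le_of_not_gt fun hlt => hv1 ⟨hv, hlt⟩)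
    obtain ⟨L, hL0, hL⟩ := hφ.exists_abs_sub_le
    rcases (measureReal_le_one : ν.real (Iic (q v)) ≤ 1).eq_or_lt with h1 | h1
    -- No level above `G(v) = 1` is available, but then both integrals equal `φ 1`.
    · have e1 := abs_integral_convex_kernel_sub_le μ κ hφ hL measurableSet_Iic .univ
        (subset_univ (Iic (q v)))
      have e2 := abs_integral_convex_kernel_sub_le μ' κ' hφ hL measurableSet_Iic .univ
        (subset_univ (Iic (q' v)))
      rw [← hν, h1] at e1
      rw [← hν', ← hG, h1] at e2
      simp only [probReal_univ, integral_const, smul_eq_mul, one_mul, sub_self, mul_zero] at e1 e2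
      rw [abs_le] at e1 e2
      linarith
    · refine hlim hL0 (sub_pos.2 h1) fun ε hε hε1 => ?_
      have hv0 : v ≤ ν.real (Iic (q v)) := hq ▸ le_measureReal_Iic_leftQuantile ν hv
      -- Being above `G(v) = G'(v)`, the level `w` has a strictly larger quantile on both sides, and
      -- `g(w) ≤ w` bounds the mass between by `ε / 2`. Halving keeps `w < 1`.
      set w := ν.real (Iic (q v)) + ε / 2 with hw
      have hw1 : w ∈ Ioo (0 : ℝ) 1 := ⟨by linarith [hv.1], by linarith⟩
      have hlt : q v < q w := by
        rw [hq, leftQuantile_lt_iff_measureReal_lt ν hw1, ← hq]; linarith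
      have hlt' : q' v < q' w := by
        rw [hq', leftQuantile_lt_iff_measureReal_lt ν' hw1, ← hq', ← hG]; linarith
      have hgw := hg w hw1
      rw [← hq, ← hq'] at hgw
      have hgw' : ν.real (Iio (q w)) ≤ w := hq ▸ measureReal_Iio_leftQuantile_le ν hw1
      have e1 := abs_integral_convex_kernel_sub_le μ κ hφ hL measurableSet_Iic measurableSet_Iio
        (Iic_subset_Iio.2 hlt)
      have e2 := abs_integral_convex_kernel_sub_le μ' κ' hφ hL measurableSet_Iic measurableSet_Iio
        (Iic_subset_Iio.2 hlt')
      rw [← hν', ← hgw, ← hG] at e2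
      exact hclose hL0 (h w hw1 φ hφ) e1 e2 (by linarith)
  · intro h v hv φ hφ
    have hG : ∀ᵐ v ∂(volume.restrict (Ioo (0 : ℝ) 1)),
        ν.real (Iic (leftQuantile ν v)) = ν'.real (Iic (leftQuantile ν' v)) := by
      filter_upwards [h] with w hw
      rw [← hq, ← hq']
      exact hmean measurableSet_Iic measurableSet_Iic hw
    have hg : ν.real (Iio (q v)) = ν'.real (Iio (q' v)) := by
      rw [hq, hq']
      exact le_antisymm (measureReal_Iio_leftQuantile_le_of_ae hG hv)
        (measureReal_Iio_leftQuantile_le_of_ae (hG.mono fun _ => Eq.symm) hv)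
    obtain ⟨L, hL0, hL⟩ := hφ.exists_abs_sub_le
    rcases (measureReal_nonneg : 0 ≤ ν.real (Iio (q v))).eq_or_lt with h0 | h0
    -- No level below `g(v) = 0` is available, but then both integrals equal `φ 0`.
    · have e1 := abs_integral_convex_kernel_sub_le μ κ hφ hL .empty measurableSet_Iio
        (empty_subset (Iio (q v)))
      have e2 := abs_integral_convex_kernel_sub_le μ' κ' hφ hL .empty measurableSet_Iio
        (empty_subset (Iio (q' v)))
      rw [← hν, ← h0] at e1
      rw [← hν', ← hg, ← h0] at e2
      simp only [measureReal_empty, integral_const, probReal_univ, smul_eq_mul, one_mul, sub_self,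
        mul_zero] at e1 e2
      rw [abs_le] at e1 e2
      linarith
    · refine hlim hL0 h0 fun ε hε hε1 => ?_
      have hv1 : ν.real (Iio (q v)) ≤ v := hq ▸ measureReal_Iio_leftQuantile_le ν hv
      -- A good level within `ε` below `g(v) = g'(v)`: its quantile is strictly smaller on both
      -- sides, and `w ≤ G(w)` bounds the mass between by `ε`.
      obtain ⟨w, hw, hw2, hGw⟩ := exists_mem_Ioo_of_ae (h.and hG)
        (a := ν.real (Iio (q v)) - ε) (b := ν.real (Iio (q v))) (by linarith)
        (hv1.trans hv.2.le) (by linarith)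
      have hw1 : w ∈ Ioo (0 : ℝ) 1 := ⟨by linarith [hw.1], hw.2.trans_le (hv1.trans hv.2.le)⟩
      rw [← hq, ← hq'] at hGw
      have hlt : q w < q v := by
        rw [hq, leftQuantile_lt_iff_measureReal_lt ν hv]
        exact measureReal_Iic_leftQuantile_lt ν hv hw1 (hq ▸ hw.2)
      have hlt' : q' w < q' v := by
        rw [hq', leftQuantile_lt_iff_measureReal_lt ν' hv]
        exact measureReal_Iic_leftQuantile_lt ν' hv hw1 (hq' ▸ hg ▸ hw.2)
      have hGw' : w ≤ ν.real (Iic (q w)) := hq ▸ le_measureReal_Iic_leftQuantile ν hw1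
      have e1 := abs_integral_convex_kernel_sub_le μ κ hφ hL measurableSet_Iic measurableSet_Iio
        (Iic_subset_Iio.2 hlt)
      have e2 := abs_integral_convex_kernel_sub_le μ' κ' hφ hL measurableSet_Iic measurableSet_Iio
        (Iic_subset_Iio.2 hlt')
      rw [← hν', ← hGw, ← hg] at e2
      rw [abs_sub_comm] at e1 e2
      exact hclose hL0 (hw2 φ hφ) e1 e2 (by linarith [hw.1])

/-! ### Both statements in terms of conditional distributions. -/

theorem integral_condSurvival {Ω : Type*} [MeasurableSpace Ω] (P : Measure Ω)
    [IsProbabilityMeasure P] {p : ℕ} {Y : Ω → ℝ} {X : Ω → Fin p → ℝ} (hY : Measurable Y)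
    (hX : Measurable X) (v : ℝ) {φ : ℝ → ℝ} (hφ : Continuous φ) :
    ∫ ω, φ (condSurvival P Y X v ω) ∂P =
      ∫ x, φ (1 - (condDistrib Y X P x).real (Iio (leftQuantile (P.map Y) v))) ∂(P.map X) := by
  have h := condDistrib_ae_eq_condExp (μ := P) hX hY
    (measurableSet_Ici (a := leftQuantile (P.map Y) v))
  have hm := (condDistrib Y X P).measurable_real
    (measurableSet_Iio (a := leftQuantile (P.map Y) v))
  rw [integral_map hX.aemeasurable
    (hφ.comp_aestronglyMeasurable (hm.const_sub 1).aestronglyMeasurable)]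
  refine integral_congr_ae (h.symm.mono fun ω hω => ?_)
  change φ ((P⟦Y ⁻¹' Ici (leftQuantile (P.map Y) v) | MeasurableSpace.comap X inferInstance⟧) ω) = _
  rw [hω]
  simp only [← compl_Iio, probReal_compl_eq_one_sub measurableSet_Iio]

theorem ConvexOn.comp_one_sub {φ : ℝ → ℝ} (hφ : ConvexOn ℝ univ φ) :
    ConvexOn ℝ univ fun x => φ (1 - x) := by
  refine ⟨convex_univ, fun x _ y _ a b ha hb hab => ?_⟩
  have h := hφ.2 (mem_univ (1 - x)) (mem_univ (1 - y)) ha hb hab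
  have he : a • (1 - x) + b • (1 - y) = 1 - (a • x + b • y) := by
    simp only [smul_eq_mul]
    linear_combination hab
  rwa [he] at h

theorem convexOrderLE_condSurvival_iff {Ω Ω' : Type*} [MeasurableSpace Ω] [MeasurableSpace Ω']
    (P : Measure Ω) [IsProbabilityMeasure P] (P' : Measure Ω') [IsProbabilityMeasure P']
    {p p' : ℕ} {Y : Ω → ℝ} {X : Ω → Fin p → ℝ} {Y' : Ω' → ℝ} {X' : Ω' → Fin p' → ℝ}
    (hY : Measurable Y) (hX : Measurable X) (hY' : Measurable Y') (hX' : Measurable X') (v : ℝ) :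
    ConvexOrderLE P (condSurvival P Y X v) P' (condSurvival P' Y' X' v) ↔
      ∀ φ : ℝ → ℝ, ConvexOn ℝ univ φ →
        ∫ x, φ ((condDistrib Y X P x).real (Iio (leftQuantile (P.map Y) v))) ∂(P.map X) ≤
        ∫ x, φ ((condDistrib Y' X' P' x).real (Iio (leftQuantile (P'.map Y') v))) ∂(P'.map X') := by
  constructor
  · intro h φ hφ
    have := h _ hφ.comp_one_sub
    rw [integral_condSurvival P hY hX v hφ.comp_one_sub.continuous_real,
      integral_condSurvival P' hY' hX' v hφ.comp_one_sub.continuous_real] at this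
    simpa only [sub_sub_cancel] using this
  · intro h φ hφ
    rw [integral_condSurvival P hY hX v hφ.continuous_real,
      integral_condSurvival P' hY' hX' v hφ.continuous_real]
    exact h _ hφ.comp_one_sub

theorem etaFun_mem_Icc {Ω : Type*} [MeasurableSpace Ω] (P : Measure Ω)
    [IsProbabilityMeasure P] {p : ℕ} (Y : Ω → ℝ) (X : Ω → Fin p → ℝ) (v : ℝ) (u : Fin p → ℝ) :
    etaFun P Y X v u ∈ Icc (0 : ℝ) 1 :=
  ⟨measureReal_nonneg, measureReal_le_one⟩

/-- On the cube the quantile transform equals a measurable map with the law of `X`; off the cube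
nothing is known, hence only a.e. measurability. -/
theorem etaFun_law {Ω : Type*} [MeasurableSpace Ω] (P : Measure Ω)
    [IsProbabilityMeasure P] {p : ℕ} (Y : Ω → ℝ) {X : Ω → Fin p → ℝ}
    (hX : Measurable X) (v : ℝ) :
    AEMeasurable (etaFun P Y X v) (volume.restrict (unitCube p)) ∧
      ∀ φ : ℝ → ℝ, Continuous φ → ∫ u in unitCube p, φ (etaFun P Y X v u) =
        ∫ x, φ ((condDistrib Y X P x).real (Iic (leftQuantile (P.map Y) v))) ∂(P.map X) := by
  obtain ⟨T, hT, hTe, hTl⟩ := quantileTransform_law P p X hX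
  have hm := (condDistrib Y X P).measurable_real
    (measurableSet_Iic (a := leftQuantile (P.map Y) v))
  have he : EqOn (etaFun P Y X v)
      (fun u => (condDistrib Y X P (T u)).real (Iic (leftQuantile (P.map Y) v))) (unitCube p) :=
    fun u hu => by simp only [etaFun, hTe hu]
  refine ⟨⟨_, hm.comp hT, (ae_restrict_mem (measurableSet_unitCube p)).mono he⟩, fun φ hφ => ?_⟩
  rw [← hTl, integral_map hT.aemeasurable
    (hφ.comp_aestronglyMeasurable hm.aestronglyMeasurable)]
  exact setIntegral_congr_fun (measurableSet_unitCube p) fun u hu => congrArg φ (he hu)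

theorem theorem4 {Ω Ω' : Type*} [MeasurableSpace Ω] [MeasurableSpace Ω']
    (P : Measure Ω) [IsProbabilityMeasure P] (P' : Measure Ω') [IsProbabilityMeasure P']
    {p p' : ℕ} (Y : Ω → ℝ) (X : Ω → Fin p → ℝ) (Y' : Ω' → ℝ) (X' : Ω' → Fin p' → ℝ)
    (hY : Measurable Y) (hX : Measurable X) (hY' : Measurable Y') (hX' : Measurable X') :
    CondConvexOrderLE P Y X P' Y' X' ↔
      ∀ᵐ v ∂(volume.restrict (Ioo (0 : ℝ) 1)), SchurLE (etaFun P Y X v) (etaFun P' Y' X' v) := by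
  have := Measure.isProbabilityMeasure_map (μ := P) hX.aemeasurable
  have := Measure.isProbabilityMeasure_map (μ := P') hX'.aemeasurable
  have hS : ∀ v, SchurLE (etaFun P Y X v) (etaFun P' Y' X' v) ↔
      ∀ φ : ℝ → ℝ, ConvexOn ℝ univ φ →
        ∫ x, φ ((condDistrib Y X P x).real (Iic (leftQuantile (P.map Y) v))) ∂(P.map X) ≤
        ∫ x, φ ((condDistrib Y' X' P' x).real
          (Iic (leftQuantile (P'.map Y') v))) ∂(P'.map X') := fun v => by
    obtain ⟨hm, hi⟩ := etaFun_law P Y hX v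
    obtain ⟨hm', hi'⟩ := etaFun_law P' Y' hX' v
    rw [schurLE_iff hm (etaFun_mem_Icc P Y X v) hm' (etaFun_mem_Icc P' Y' X' v)]
    refine forall₂_congr fun φ hφ => ?_
    rw [hi φ hφ.continuous_real, hi' φ hφ.continuous_real]
  simp_rw [hS]
  rw [← forall_Iio_le_iff_ae_Iic_le (P.map X) (condDistrib Y X P) (P'.map X') (condDistrib Y' X' P')
    -- Mixing the conditional laws over the law of `X` returns the law of `Y`, so the quantiles
    -- match.
    (by rw [condDistrib_comp_map hX.aemeasurable hY.aemeasurable])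
    (by rw [condDistrib_comp_map hX'.aemeasurable hY'.aemeasurable])]
  exact forall₂_congr fun v _ => convexOrderLE_condSurvival_iff P P' hY hX hY' hX' v
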